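/- Let $d\ge 1$, let $|\cdot|$ be the maximum norm on $\mathbb Z^d$, and let $J:\mathbb Z^d\times\mathbb Z^d\to\mathbb R$ be a pairwise potential: $J(i,i)=0$, $J(i,j)=J(j,i)$ and $\sup_i\sum_j|J(i,j)|<\infty$. An Ising model with potential $J$ is a random element $X$ of $\{-1,1\}^{\mathbb Z^d}$ such that, for every site $i$ and every configuration $x$, a version of the conditional probability is $$\mathbb P\big(X(i)=x(i)\mid X(j)=x(j),\,j\ne i\big)=\frac{1}{1+\exp\big(-2\sum_{j}J(i,j)x(i)x(j)\big)} .$$ Let $X_1,X_2,\dots$ be independent copies of an Ising model with potential $J$. For a finite $F\subset\mathbb Z^d$, a site $j$ and a configuration $x$, put $$\hat p_n(x(F))=\frac1n\sum_{k=1}^n\mathbf 1\{X_k(F)=x(F)\},\qquad \hat p_n(x(j)\mid x(F\setminus\{j\}))=\frac{\hat p_n(x(F\cup\{j\}))}{\hat p_n(x(F\setminus\{j\}))},$$ the latter being $0$ if its denominator is $0$. With $B^L(i)=\{j:|i-j|\le L\}$ let, for $j\in B^L(i)$, $$\hat D_n(x(B^L(i)),j)=\big|\hat p_n(x(i)\mid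 x(B^L(i)\setminus\{i\}))-\hat p_n(x(i)\mid x(B^L(i)\setminus\{i,j\}))\big|\;\hat p_n(x(B^L(i)\setminus\{i\})),$$ and define the estimator with threshold $\epsilon$ by $$\hat V_n^{L}(i)=\Big\{j\in B^L(i):\max_{x(B^L(i))}\hat D_n(x(B^L(i)),j)>\epsilon\Big\}.$$ Assume that $$\sup_{i}\sum_{j}|J(i,j)|=r<1\qquad\text{and}\qquad \lim_{L\to\infty,\;L\in\mathbb N}\ \sup_{i}\sum_{j:\,|j-i|>L}|J(i,j)|\,e^{(2L)^d}=0 .$$ Let $C>0$ be an arbitrary constant, $L_n=\frac12(0.79\log n)^{1/d}$, and use the threshold $\epsilon=\epsilon(L_n,n)$, where $$\epsilon(L,n)=C\sqrt{\frac{(2L)^d}{n}\Big(\frac{1+e^2}{e^2}\Big)^{-(2L)^d}} .$$ Then for every $i\in\mathbb Z^d$: (i) for every $j$ with $J(i,j)\neq0$, $\lim_{n\to\infty}\mathbb P\big(j\in\hat V_n^{L_n}(i)\big)=1$; (ii) for every $j$ with $J(i,j)=0$, $\lim_{n\to\infty}\mathbb P\big(j\notin\hat V_n^{L_n}(i)\big)=1$.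 -/

import Mathlib

open MeasureTheory ProbabilityTheory Filter Topology
open scoped ENNReal

noncomputable section

namespace IsingNeighborhood

/-- Sites of the lattice `ℤ^d`; `‖·‖` on this type is the maximum norm. -/
abbrev Site (d : ℕ) : Type := Fin d → ℤ

/-- The basic binary set `{-1, 1}`. -/
abbrev Spin : Type := ({-1, 1} : Finset ℤ)

/-- Spin configurations on `ℤ^d`, with the product σ-algebra. -/
abbrev Config (d : ℕ) : Type := Site d → Spin

/-- The numerical value of a spin. -/
def spinVal (a : Spin) : ℝ := ((a : ℤ) : ℝ)

/-- Pairwise potentials. Sums of nonnegative terms are taken in `[0, ∞]`. -/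
structure IsPairwisePotential {d : ℕ} (J : Site d → Site d → ℝ) : Prop where
  diag_zero : ∀ i, J i i = 0
  symm : ∀ i j, J i j = J j i
  bounded : (⨆ i, ∑' j, ENNReal.ofReal |J i j|) < ∞

/-- The σ-algebra on configurations generated by the spins at all sites other than `i`. -/
abbrev sigmaOff {d : ℕ} (i : Site d) : MeasurableSpace (Config d) :=
  MeasurableSpace.comap (fun (x : Config d) (j : {j : Site d // j ≠ i}) => x j) inferInstance

theorem sigmaOff_le {d : ℕ} (i : Site d) :
    sigmaOff i ≤ (inferInstance : MeasurableSpace (Config d)) :=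
  Measurable.comap_le (measurable_pi_lambda _ fun j => measurable_pi_apply j.1)

/-- `μ` is the law of an Ising model with potential `J`: a version of the conditional probability
that the spin at `i` equals `a`, given the spins at all other sites, is
`1 / (1 + exp (-2 ∑ j, J i j * a * x j))`. -/
def IsIsingLaw {d : ℕ} (J : Site d → Site d → ℝ) (μ : Measure (Config d)) : Prop :=
  IsProbabilityMeasure μ ∧
    ∀ (i : Site d) (a : Spin),
      μ⟦{x : Config d | x i = a} | sigmaOff i⟧ =ᵐ[μ]
        fun x => 1 / (1 + Real.exp (-2 * ∑' j, J i j * spinVal a * spinVal (x j)))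

/-- The interaction neighborhood of the site `i`. -/
def interactionNbhd {d : ℕ} (J : Site d → Site d → ℝ) (i : Site d) : Set (Site d) :=
  {j | J i j ≠ 0}

/-- The ball of radius `L` around `i` in the maximum norm. -/
def box {d : ℕ} (L : ℝ) (i : Site d) : Set (Site d) := {j | ‖i - j‖ ≤ L}

/-- Configurations that agree with `x` on `F`. -/
def cyl {d : ℕ} (F : Set (Site d)) (x : Config d) : Set (Config d) := {y | ∀ j ∈ F, y j = x j}

/-- The empirical probability of `x(F)` in the sample `s 0, …, s (n-1)`. -/
def empProb {d : ℕ} (s : ℕ → Config d) (n : ℕ) (F : Set (Site d)) (x : Config d) : ℝ :=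
  (1 / (n : ℝ)) * ∑ k ∈ Finset.range n, (cyl F x).indicator (fun _ => (1 : ℝ)) (s k)

/-- The empirical conditional probability of `x(j)` given `x(F \ {j})`; it is `0` when the
denominator vanishes, by the convention for division in `ℝ`. -/
def empCond {d : ℕ} (s : ℕ → Config d) (n : ℕ) (j : Site d) (F : Set (Site d))
    (x : Config d) : ℝ :=
  empProb s n (F ∪ {j}) x / empProb s n (F \ {j}) x

/-- The empirical weighted distance between the conditional probabilities at `i` given the other
spins of the box, with and without the spin at `j`. It depends only on `x` restricted to the box. -/
def empDist {d : ℕ} (s : ℕ → Config d) (n : ℕ) (L : ℝ) (i : Site d) (x : Config d)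
    (j : Site d) : ℝ :=
  |empCond s n i (box L i \ {i}) x - empCond s n i (box L i \ {i, j}) x| *
    empProb s n (box L i \ {i}) x

/-- The interaction neighborhood estimator with threshold `ε`. The supremum is a maximum, since
`empDist` takes only finitely many values as `x` varies. -/
def estimator {d : ℕ} (s : ℕ → Config d) (n : ℕ) (L ε : ℝ) (i : Site d) : Set (Site d) :=
  {j | j ∈ box L i ∧ ε < ⨆ x : Config d, empDist s n L i x j}

/-- The threshold `ε(L, n)`. -/
def threshold (d : ℕ) (C L : ℝ) (n : ℕ) : ℝ :=
  C * √((2 * L) ^ d / (n : ℝ) *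
    ((1 + Real.exp 2) / Real.exp 2) ^ (-((2 * L) ^ d)))

/-- The radius `L_n = ½ (0.79 log n)^{1/d}`. -/
def radius (d n : ℕ) : ℝ := 1 / 2 * (0.79 * Real.log n) ^ (1 / (d : ℝ))

end IsingNeighborhood

end

open IsingNeighborhood

/-! Put `m = 0.79 log n = (2 L_n)^d`; the box around `i` contains `M ~ m` sites. Up to factors
`exp(o(m))`, every quantity is an exponential in `m`, and the proof compares exponents. The
threshold is `exp(-m * thresholdRate)`, where `log 2 < thresholdRate < 1`. Sampling error: adding
sites one at a time bounds a cylinder probability on `k` sites by `sig r ^ k`, while `n * ε^2 = C^2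
* m * sig 1 ^ m`. As `r < 1`, the variance scale is exponentially smaller than `n * ε^2`, so a
Chernoff bound sensitive to the variance beats the union over the `2^M` patterns. All relevant
frequencies are then within `ε / 16` of their means (`IsIsingLaw.tendsto_real_deviation`). Division
by random frequencies is avoided: the weighted distance `|a/b - c/e| * b` differs from `|a - q * b|`
by at most `|c - q * e|`, for a deterministic `q` of one's choice (`abs_weighted_ratio_sub_le`). If
`J i j = 0`, take for `q` the conditional probability at `i` with the field computed from all of
`x`. Both expressions are then at most the sampling error plus the interaction `θ` beyond the box,
which is below roughly `exp(-m)` and so negligible against `ε` (`IsIsingLaw.empDist_le`). If `J i j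
≠ 0`, take for `q` the true conditional probability without `j`. Flipping `j` moves the conditional
probability at `i` by a fixed amount, so the true distance is at least a constant times the cylinder
probability. Some pattern on the box has probability at least `2^(-M)`, which dominates `ε` because
`thresholdRate > log 2` (`IsIsingLaw.exists_le_empDist`). -/

namespace IsingNeighborhood

/-! ### The logistic function. -/

/-- The conditional probability of a spin as a function of its signed local field. -/
noncomputable def sig (s : ℝ) : ℝ := 1 / (1 + Real.exp (-2 * s))

theorem sig_pos (s : ℝ) : 0 < sig s := by unfold sig; positivity

theorem sig_lt_one (s : ℝ) : sig s < 1 := by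
  unfold sig
  rw [div_lt_one (by positivity)]
  linarith [Real.exp_pos (-2 * s)]

theorem sig_strictMono : StrictMono sig := by
  intro s t h
  unfold sig
  apply one_div_lt_one_div_of_lt (by positivity)
  have : Real.exp (-2 * t) < Real.exp (-2 * s) := Real.exp_lt_exp.2 (by linarith)
  linarith

theorem continuous_sig : Continuous sig := by
  unfold sig
  exact continuous_const.div (by fun_prop) fun s => by positivity

theorem sig_neg (s : ℝ) : sig (-s) = 1 - sig s := by
  unfold sig
  have h : Real.exp (-2 * -s) = (Real.exp (-2 * s))⁻¹ := by rw [← Real.exp_neg]; ring_nf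
  rw [h]
  have := Real.exp_pos (-2 * s)
  field_simp
  ring

theorem hasDerivAt_sig (s : ℝ) : HasDerivAt sig (2 * (sig s * (1 - sig s))) s := by
  have h1 : HasDerivAt (fun s : ℝ => 1 + Real.exp (-2 * s)) (Real.exp (-2 * s) * (-2)) s := by
    have := ((hasDerivAt_id s).const_mul (-2 : ℝ)).exp.const_add 1
    simpa using this
  have h2 := h1.inv (by positivity)
  have h3 : (fun s : ℝ => 1 + Real.exp (-2 * s))⁻¹ = sig := by
    funext s; simp [sig]
  rw [h3] at h2
  refine h2.congr_deriv ?_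
  have := Real.exp_pos (-2 * s)
  simp only [sig]
  field_simp
  ring

theorem abs_sig_sub_le (s t : ℝ) : |sig s - sig t| ≤ 1 / 2 * |s - t| := by
  have := Convex.norm_image_sub_le_of_norm_hasDerivWithin_le (f := sig)
    (f' := fun s => 2 * (sig s * (1 - sig s))) (C := 1 / 2) (s := Set.univ) (x := t) (y := s)
    (fun x _ => (hasDerivAt_sig x).hasDerivWithinAt)
    (fun x _ => by
      have h0 := sig_pos x
      have h1 := sig_lt_one x
      rw [Real.norm_of_nonneg (by nlinarith)]
      nlinarith [sq_nonneg (2 * sig x - 1)])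
    convex_univ (Set.mem_univ _) (Set.mem_univ _)
  simpa [Real.norm_eq_abs] using this

/-- Compactness of `[-1, 1]` and injectivity of `sig`. With `b = ± 2 * J i j` this is the effect at
`i` of flipping the spin at `j`, uniformly over configurations. -/
theorem exists_sig_gap {b : ℝ} (hb : b ≠ 0) :
    ∃ κ > 0, ∀ s, |s| ≤ 1 → κ ≤ |sig s - sig (s - b)| := by
  obtain ⟨s₀, -, hs₀⟩ := (isCompact_Icc (a := (-1 : ℝ)) (b := 1)).exists_isMinOn
    ⟨0, by norm_num⟩ (f := fun s => |sig s - sig (s - b)|)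
    (by have := continuous_sig; fun_prop)
  refine ⟨|sig s₀ - sig (s₀ - b)|, abs_pos.2 fun h => hb ?_, fun s hs => hs₀ (abs_le.1 hs)⟩
  have := sig_strictMono.injective (sub_eq_zero.1 h)
  linarith

/-! ### Spins and local fields. -/

variable {d : ℕ}

theorem abs_spinVal (a : Spin) : |spinVal a| = 1 := by
  obtain ⟨a, ha⟩ := a
  simp only [Finset.mem_insert, Finset.mem_singleton] at ha
  rcases ha with rfl | rfl <;> simp [spinVal]

theorem card_spin : Fintype.card Spin = 2 := by simp [Spin]

/-- The opposite spin. -/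
def oppositeSpin (a : Spin) : Spin := ⟨-a.1, by
  have := a.2
  simp only [Finset.mem_insert, Finset.mem_singleton] at this ⊢
  omega⟩

theorem spinVal_flip (a : Spin) : spinVal (oppositeSpin a) = -spinVal a := by simp [spinVal, oppositeSpin]

theorem eq_or_eq_flip (a b : Spin) : b = a ∨ b = oppositeSpin a := by
  obtain ⟨a, ha⟩ := a
  obtain ⟨b, hb⟩ := b
  simp only [Finset.mem_insert, Finset.mem_singleton] at ha hb
  simp only [oppositeSpin, Subtype.mk.injEq]
  omega

theorem flip_ne (a : Spin) : oppositeSpin a ≠ a := by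
  obtain ⟨a, ha⟩ := a
  simp only [Finset.mem_insert, Finset.mem_singleton] at ha
  simp only [oppositeSpin, Ne, Subtype.mk.injEq]
  omega

/-- The signed local field acting on the spin `a` at `i` in the configuration `y`. -/
noncomputable def siteField (J : Site d → Site d → ℝ) (i : Site d) (a : Spin) (y : Config d) : ℝ :=
  ∑' j, J i j * spinVal a * spinVal (y j)

section Field

variable {J : Site d → Site d → ℝ} {i : Site d}

theorem abs_field_term (a b : Spin) (j : Site d) : |J i j * spinVal a * spinVal b| = |J i j| := by
  rw [abs_mul, abs_mul, abs_spinVal, abs_spinVal, mul_one, mul_one]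

theorem summable_field (hs : Summable fun j => |J i j|) (a : Spin) (y : Config d) :
    Summable fun j => J i j * spinVal a * spinVal (y j) :=
  Summable.of_abs (by simpa only [abs_field_term] using hs)

theorem abs_siteField_le (hs : Summable fun j => |J i j|) (a : Spin) (y : Config d) :
    |siteField J i a y| ≤ ∑' j, |J i j| := by
  have h := norm_tsum_le_tsum_norm (f := fun j => J i j * spinVal a * spinVal (y j))
    (by simpa only [Real.norm_eq_abs, abs_field_term] using hs)
  simpa only [siteField, Real.norm_eq_abs, abs_field_term] using h

theorem abs_siteField_sub_le (hs : Summable fun j => |J i j|) (a : Spin) {S : Set (Site d)}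
    {y z : Config d} (h : ∀ k, k ∉ S → J i k = 0 ∨ y k = z k) :
    |siteField J i a y - siteField J i a z| ≤ 2 * ∑' k, S.indicator (fun k => |J i k|) k := by
  unfold siteField
  rw [← (summable_field hs a y).tsum_sub (summable_field hs a z), ← tsum_mul_left]
  have hS : Summable fun k => 2 * S.indicator (fun k => |J i k|) k := (hs.indicator S).mul_left 2
  refine tsum_of_norm_bounded (f := fun k => J i k * spinVal a * spinVal (y k) -
    J i k * spinVal a * spinVal (z k)) hS.hasSum fun k => ?_
  by_cases hk : k ∈ S
  · rw [Set.indicator_of_mem hk, Real.norm_eq_abs]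
    calc _ ≤ |J i k * spinVal a * spinVal (y k)| + |J i k * spinVal a * spinVal (z k)| := abs_sub _ _
      _ = _ := by rw [abs_field_term, abs_field_term]; ring
  · rw [Set.indicator_of_notMem hk]
    rcases h k hk with h | h <;> simp [h]

theorem siteField_update_flip [DecidableEq (Site d)] (hs : Summable fun j => |J i j|) (a : Spin)
    (y : Config d) (j : Site d) :
    siteField J i a (Function.update y j (oppositeSpin (y j))) =
      siteField J i a y - 2 * (J i j * spinVal a * spinVal (y j)) := by
  have h : siteField J i a y - siteField J i a (Function.update y j (oppositeSpin (y j))) =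
      2 * (J i j * spinVal a * spinVal (y j)) := by
    unfold siteField
    rw [← (summable_field hs a y).tsum_sub (summable_field hs a _), tsum_eq_single j]
    · simp only [Function.update_self, spinVal_flip]; ring
    · intro k hk
      rw [Function.update_of_ne hk, sub_self]
  linarith

end Field

/-! ### Cylinder probabilities under an Ising law. -/

theorem measurableSet_cyl (F : Set (Site d)) (x : Config d) : MeasurableSet (cyl F x) := by
  have : cyl F x = ⋂ j ∈ F, (fun y : Config d => y j) ⁻¹' {x j} := by ext y; simp [cyl]
  rw [this]
  exact MeasurableSet.biInter F.to_countable fun j _ => measurable_pi_apply j (measurableSet_singleton _)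

theorem measurableSet_cyl_sigmaOff {i : Site d} {F : Set (Site d)} (hi : i ∉ F) (x : Config d) :
    MeasurableSet[sigmaOff i] (cyl F x) := by
  refine ⟨⋂ j ∈ {j : {j : Site d // j ≠ i} | j.1 ∈ F},
    (fun y : {j : Site d // j ≠ i} → Spin => y j) ⁻¹' {x j},
    MeasurableSet.biInter (Set.to_countable _) fun j _ =>
      measurable_pi_apply j (measurableSet_singleton _), ?_⟩
  ext y
  simp only [Set.mem_preimage, Set.mem_iInter, Set.mem_singleton_iff, cyl, Set.mem_ofPred_eq,
    Subtype.forall]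
  exact ⟨fun h j hj => h j (fun e => hi (e ▸ hj)) hj, fun h j _ hj => h j hj⟩

theorem cyl_insert (i : Site d) (F : Set (Site d)) (x : Config d) :
    cyl (insert i F) x = {y | y i = x i} ∩ cyl F x := by
  ext y; simp [cyl]

theorem cyl_congr {F : Set (Site d)} {x z : Config d} (h : ∀ k ∈ F, x k = z k) :
    cyl F x = cyl F z := by
  ext y
  exact ⟨fun hy k hk => (hy k hk).trans (h k hk), fun hy k hk => (hy k hk).trans (h k hk).symm⟩

theorem cyl_anti {F G : Set (Site d)} (h : F ⊆ G) (x : Config d) : cyl G x ⊆ cyl F x :=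
  fun _ hy k hk => hy k (h hk)

section Law

variable {J : Site d → Site d → ℝ} {μ : Measure (Config d)}

theorem IsIsingLaw.integrable_sig (hμ : IsIsingLaw J μ) (i : Site d) (a : Spin) :
    Integrable (fun y => sig (siteField J i a y)) μ :=
  integrable_condExp.congr (hμ.2 i a)

/-- The cylinder on `F` is measurable with respect to the spins off `i`, so the defining property of
conditional expectation applies. All later bounds on the law come from this integral formula. -/
theorem IsIsingLaw.real_cyl_insert (hμ : IsIsingLaw J μ) {i : Site d} {F : Set (Site d)}
    (hi : i ∉ F) (x : Config d) :
    μ.real (cyl (insert i F) x) = ∫ y in cyl F x, sig (siteField J i (x i) y) ∂μ := by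
  have := hμ.1
  have hA : MeasurableSet {y : Config d | y i = x i} :=
    measurableSet_eq_fun (measurable_pi_apply i) measurable_const
  have h1 : ∫ y in cyl F x, sig (siteField J i (x i) y) ∂μ =
      ∫ y in cyl F x, (μ⟦{y : Config d | y i = x i} | sigmaOff i⟧) y ∂μ := by
    refine setIntegral_congr_ae (measurableSet_cyl F x) ?_
    filter_upwards [hμ.2 i (x i)] with y hy _
    exact hy.symm
  rw [h1, setIntegral_condExp (sigmaOff_le i) ((integrable_const _).indicator hA)
    (measurableSet_cyl_sigmaOff hi x), setIntegral_indicator hA, cyl_insert, Set.inter_comm]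
  simp

theorem IsIsingLaw.real_cyl_insert_le (hμ : IsIsingLaw J μ) {i : Site d} {F : Set (Site d)}
    (hi : i ∉ F) (x : Config d) {u : ℝ} (h : ∀ y ∈ cyl F x, sig (siteField J i (x i) y) ≤ u) :
    μ.real (cyl (insert i F) x) ≤ u * μ.real (cyl F x) := by
  have := hμ.1
  rw [hμ.real_cyl_insert hi]
  calc _ ≤ ∫ _ in cyl F x, u ∂μ := setIntegral_mono_on (hμ.integrable_sig i _).integrableOn
        (integrable_const u).integrableOn (measurableSet_cyl F x) h
    _ = _ := by simp [mul_comm]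

theorem IsIsingLaw.le_real_cyl_insert (hμ : IsIsingLaw J μ) {i : Site d} {F : Set (Site d)}
    (hi : i ∉ F) (x : Config d) {l : ℝ} (h : ∀ y ∈ cyl F x, l ≤ sig (siteField J i (x i) y)) :
    l * μ.real (cyl F x) ≤ μ.real (cyl (insert i F) x) := by
  have := hμ.1
  rw [hμ.real_cyl_insert hi]
  calc l * μ.real (cyl F x) = ∫ _ in cyl F x, l ∂μ := by simp [mul_comm]
    _ ≤ _ := setIntegral_mono_on (integrable_const l).integrableOn
        (hμ.integrable_sig i _).integrableOn (measurableSet_cyl F x) h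

/-- Each added site multiplies the probability by a conditional probability of at most `sig r`,
since the local field is at most `r`. -/
theorem IsIsingLaw.real_cyl_le_pow (hμ : IsIsingLaw J μ) {r : ℝ}
    (hs : ∀ i, Summable fun j => |J i j|) (hr : ∀ i, ∑' j, |J i j| ≤ r)
    (F : Finset (Site d)) (x : Config d) : μ.real (cyl (F : Set (Site d)) x) ≤ sig r ^ F.card := by
  classical
  have := hμ.1
  induction F using Finset.induction_on with
  | empty => simp [cyl]
  | insert i F hi ih =>
    rw [Finset.card_insert_of_notMem hi, Finset.coe_insert, pow_succ']
    refine (hμ.real_cyl_insert_le (by simpa using hi) x fun y _ =>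
      sig_strictMono.monotone ?_).trans (mul_le_mul_of_nonneg_left ih (sig_pos r).le)
    exact (le_abs_self _).trans ((abs_siteField_le (hs i) _ y).trans (hr i))

theorem IsIsingLaw.le_real_cyl_insert_sig (hμ : IsIsingLaw J μ) {r : ℝ}
    (hs : ∀ i, Summable fun j => |J i j|) (hr : ∀ i, ∑' j, |J i j| ≤ r)
    {i : Site d} {F : Set (Site d)} (hi : i ∉ F) (x : Config d) :
    (1 - sig r) * μ.real (cyl F x) ≤ μ.real (cyl (insert i F) x) := by
  refine hμ.le_real_cyl_insert hi x fun y _ => ?_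
  rw [← sig_neg]
  refine sig_strictMono.monotone ?_
  have := (abs_le.1 ((abs_siteField_le (hs i) (x i) y).trans (hr i))).1
  linarith

/-- Freezing the spins of `F` determines the conditional probability up to the interaction with
the remaining sites. -/
theorem IsIsingLaw.abs_real_cyl_insert_sub_le (hμ : IsIsingLaw J μ) {i : Site d}
    (hs : Summable fun j => |J i j|) {F S : Set (Site d)} (hi : i ∉ F)
    (hFS : ∀ k, k ∉ S → J i k = 0 ∨ k ∈ F) (x : Config d) :
    |μ.real (cyl (insert i F) x) - sig (siteField J i (x i) x) * μ.real (cyl F x)| ≤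
      (∑' k, S.indicator (fun k => |J i k|) k) * μ.real (cyl F x) := by
  set θ := ∑' k, S.indicator (fun k => |J i k|) k
  -- The Lipschitz constant `1 / 2` of `sig` cancels the factor `2` lost when spins in `S` may
  -- disagree.
  have key : ∀ y ∈ cyl F x,
      |sig (siteField J i (x i) y) - sig (siteField J i (x i) x)| ≤ θ := fun y hy => by
    have h1 := abs_siteField_sub_le hs (x i) (S := S) (y := y) (z := x)
      fun k hk => (hFS k hk).imp id (hy k)
    have h2 := abs_sig_sub_le (siteField J i (x i) y) (siteField J i (x i) x)
    linarith
  have hu := hμ.real_cyl_insert_le hi x (u := sig (siteField J i (x i) x) + θ)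
    fun y hy => by linarith [(abs_le.1 (key y hy)).2]
  have hl := hμ.le_real_cyl_insert hi x (l := sig (siteField J i (x i) x) - θ)
    fun y hy => by linarith [(abs_le.1 (key y hy)).1]
  rw [abs_le]
  constructor <;> nlinarith

end Law

end IsingNeighborhood

/-! ### Concentration of empirical frequencies. -/

namespace IsingNeighborhood

section Chernoff

variable {Ω E : Type*} [MeasurableSpace Ω] [MeasurableSpace E] {P : Measure Ω}
  [IsProbabilityMeasure P]

/-- The exact value is `exp(-t p) * (1 + p (exp t - 1))`; apply `1 + u ≤ exp u`, then `exp t - 1 - t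
≤ t^2`. Keeping the factor `p` in the exponent is essential: a Hoeffding bound would ignore that
cylinders are exponentially rare. -/
theorem mgf_centered_indicator_le {Y : Ω → E} (hY : Measurable Y) {A : Set E}
    (hA : MeasurableSet A) {t : ℝ} (ht : |t| ≤ 1) :
    mgf (fun ω => A.indicator (fun _ => (1 : ℝ)) (Y ω) - (P.map Y).real A) P t ≤
      Real.exp ((P.map Y).real A * t ^ 2) := by
  set p := (P.map Y).real A with hp
  have hpA : p = P.real (Y ⁻¹' A) := by rw [hp, map_measureReal_apply hY hA]
  have hp0 : 0 ≤ p := measureReal_nonneg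
  have h1 : ∀ ω, Real.exp (t * (A.indicator (fun _ => (1 : ℝ)) (Y ω) - p)) =
      Real.exp (-(t * p)) +
        (Y ⁻¹' A).indicator (fun _ => Real.exp (-(t * p)) * (Real.exp t - 1)) ω := by
    intro ω
    by_cases h : Y ω ∈ A
    · rw [Set.indicator_of_mem h, Set.indicator_of_mem (show ω ∈ Y ⁻¹' A from h),
        show t * (1 - p) = -(t * p) + t by ring, Real.exp_add]
      ring
    · rw [Set.indicator_of_notMem h, Set.indicator_of_notMem (show ω ∉ Y ⁻¹' A from h)]
      ring_nf
  unfold mgf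
  simp_rw [h1]
  rw [integral_add (integrable_const _) ((integrable_const _).indicator (hY hA)),
    integral_indicator (hY hA)]
  simp only [integral_const, probReal_univ, smul_eq_mul, one_mul, measureReal_restrict_apply_univ]
  rw [← hpA]
  calc _ = Real.exp (-(t * p)) * (p * (Real.exp t - 1) + 1) := by ring
    _ ≤ Real.exp (-(t * p)) * Real.exp (p * (Real.exp t - 1)) := by
        gcongr; exact Real.add_one_le_exp _
    _ = Real.exp (p * (Real.exp t - 1 - t)) := by rw [← Real.exp_add]; ring_nf
    _ ≤ _ := by
        gcongr
        exact (le_abs_self _).trans (Real.abs_exp_sub_one_sub_id_le ht)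

/-- Chernoff bound for the number of visits of an i.i.d. sample to a set. -/
theorem real_abs_sum_indicator_ge_le {Y : ℕ → Ω → E} (hY : ∀ k, Measurable (Y k))
    (hind : iIndepFun Y P) {ν : Measure E} (hlaw : ∀ k, P.map (Y k) = ν) {A : Set E}
    (hA : MeasurableSet A) {t δ : ℝ} (ht0 : 0 ≤ t) (ht1 : t ≤ 1) (n : ℕ) :
    P.real {ω | n * δ ≤
        |∑ k ∈ Finset.range n, (A.indicator (fun _ => (1 : ℝ)) (Y k ω) - ν.real A)|} ≤
      2 * Real.exp (n * (ν.real A * t ^ 2 - t * δ)) := by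
  set Z : ℕ → Ω → ℝ := fun k ω => A.indicator (fun _ => (1 : ℝ)) (Y k ω) - ν.real A with hZ
  have hg : Measurable fun y : E => A.indicator (fun _ => (1 : ℝ)) y - ν.real A :=
    (measurable_const.indicator hA).sub_const _
  have hZm : ∀ k, Measurable (Z k) := fun k => hg.comp (hY k)
  have hZi : iIndepFun Z P := hind.comp (fun _ y => A.indicator (fun _ => (1 : ℝ)) y - ν.real A)
    fun _ => hg
  have hmgf : ∀ s : ℝ, |s| ≤ 1 → mgf (∑ k ∈ Finset.range n, Z k) P s ≤
      Real.exp (n * (ν.real A * s ^ 2)) := fun s hs => by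
    rw [hZi.mgf_sum hZm]
    calc _ ≤ ∏ _k ∈ Finset.range n, Real.exp (ν.real A * s ^ 2) :=
          Finset.prod_le_prod (fun _ _ => mgf_nonneg) fun k _ => by
            have := mgf_centered_indicator_le (P := P) (hY k) hA hs
            rwa [hlaw k] at this
      _ = _ := by rw [Finset.prod_const, Finset.card_range, ← Real.exp_nat_mul]
  have hexpInt : ∀ s : ℝ, Integrable (fun ω => Real.exp (s * (∑ k ∈ Finset.range n, Z k) ω)) P :=
    fun s => hZi.integrable_exp_mul_sum hZm fun k _ => by
      refine Integrable.of_bound (C := Real.exp (|s| * (1 + |ν.real A|)))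
        ((hZm k).const_mul s).exp.aestronglyMeasurable (ae_of_all _ fun ω => ?_)
      rw [Real.norm_of_nonneg (Real.exp_pos _).le]
      refine Real.exp_le_exp.2 ((le_abs_self _).trans ?_)
      rw [abs_mul]
      refine mul_le_mul_of_nonneg_left ((abs_sub _ _).trans ?_) (abs_nonneg _)
      gcongr
      by_cases h : Y k ω ∈ A <;> simp [h]
  have hup := measure_ge_le_exp_mul_mgf (n * δ) ht0 (hexpInt t)
  have hlo := measure_le_le_exp_mul_mgf (-(n * δ)) (neg_nonpos.2 ht0) (hexpInt (-t))
  have e1 := hmgf t (by rwa [abs_of_nonneg ht0])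
  have e2 := hmgf (-t) (by rwa [abs_neg, abs_of_nonneg ht0])
  have hsub : {ω | n * δ ≤ |∑ k ∈ Finset.range n, Z k ω|} ⊆
      {ω | n * δ ≤ (∑ k ∈ Finset.range n, Z k) ω} ∪
        {ω | (∑ k ∈ Finset.range n, Z k) ω ≤ -(n * δ)} := fun ω hω => by
    simp only [Set.mem_ofPred_eq, Set.mem_union, Finset.sum_apply] at hω ⊢
    rcases le_abs.1 hω with h | h
    · exact Or.inl h
    · exact Or.inr (by linarith)
  have b1 : Real.exp (-t * (n * δ)) * mgf (∑ k ∈ Finset.range n, Z k) P t ≤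
      Real.exp (n * (ν.real A * t ^ 2 - t * δ)) := by
    refine (mul_le_mul_of_nonneg_left e1 (Real.exp_pos _).le).trans ?_
    rw [← Real.exp_add]
    exact Real.exp_le_exp.2 (by linarith)
  have b2 : Real.exp (- -t * -(n * δ)) * mgf (∑ k ∈ Finset.range n, Z k) P (-t) ≤
      Real.exp (n * (ν.real A * t ^ 2 - t * δ)) := by
    refine (mul_le_mul_of_nonneg_left e2 (Real.exp_pos _).le).trans ?_
    rw [← Real.exp_add]
    exact Real.exp_le_exp.2 (by linarith [neg_sq t])
  calc _ ≤ _ := measureReal_mono hsub (measure_ne_top _ _)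
    _ ≤ _ := measureReal_union_le _ _
    _ ≤ _ := by linarith

end Chernoff

variable {d : ℕ}

theorem real_abs_empProb_sub_ge_le {Ω : Type*} [MeasurableSpace Ω] {P : Measure Ω}
    [IsProbabilityMeasure P] {μ : Measure (Config d)} {X : ℕ → Ω → Config d}
    (hX : ∀ k, Measurable (X k)) (hlaw : ∀ k, P.map (X k) = μ) (hind : iIndepFun X P)
    (F : Set (Site d)) (x : Config d) {t δ : ℝ} (ht0 : 0 ≤ t) (ht1 : t ≤ 1) {n : ℕ}
    (hn : 0 < n) :
    P.real {ω | δ ≤ |empProb (fun k => X k ω) n F x - μ.real (cyl F x)|} ≤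
      2 * Real.exp (n * (μ.real (cyl F x) * t ^ 2 - t * δ)) := by
  refine le_trans (measureReal_mono fun ω hω => ?_)
    (real_abs_sum_indicator_ge_le hX hind hlaw (measurableSet_cyl F x) ht0 ht1 n)
  have hn' : (0 : ℝ) < n := by exact_mod_cast hn
  simp only [Set.mem_ofPred_eq, empProb] at hω ⊢
  rw [Finset.sum_sub_distrib, Finset.sum_const, Finset.card_range, nsmul_eq_mul]
  refine (mul_le_mul_of_nonneg_left hω hn'.le).trans (le_of_eq ?_)
  rw [← abs_of_pos hn', ← abs_mul, abs_of_pos hn']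
  congr 1
  field_simp

/-- All empirical probabilities of blocks inside a finite window are simultaneously close to
the true ones. -/
theorem real_exists_abs_empProb_sub_ge_le {Ω : Type*} [MeasurableSpace Ω] {P : Measure Ω}
    [IsProbabilityMeasure P] {μ : Measure (Config d)} {X : ℕ → Ω → Config d}
    (hX : ∀ k, Measurable (X k)) (hlaw : ∀ k, P.map (X k) = μ) (hind : iIndepFun X P)
    (B : Finset (Site d)) (S : Finset (Set (Site d))) (hSB : ∀ F ∈ S, F ⊆ (B : Set (Site d)))
    {p t δ : ℝ} (hp : ∀ F ∈ S, ∀ x, μ.real (cyl F x) ≤ p) (ht0 : 0 ≤ t) (ht1 : t ≤ 1) {n : ℕ}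
    (hn : 0 < n) :
    P.real {ω | ∃ F ∈ S, ∃ x, δ ≤ |empProb (fun k => X k ω) n F x - μ.real (cyl F x)|} ≤
      S.card * 2 ^ B.card * (2 * Real.exp (n * (p * t ^ 2 - t * δ))) := by
  classical
  -- Frequencies of blocks in `B` depend only on the pattern on `B`, so the quantifier over all
  -- configurations reduces to `2 ^ B.card` representatives; the spin outside `B` is arbitrary.
  let ext : (B → Spin) → Config d := fun y k => if h : k ∈ B then y ⟨k, h⟩ else ⟨1, by simp⟩
  have hsub : {ω | ∃ F ∈ S, ∃ x, δ ≤ |empProb (fun k => X k ω) n F x - μ.real (cyl F x)|} ⊆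
      ⋃ q ∈ S ×ˢ (Finset.univ : Finset (B → Spin)),
        {ω | δ ≤ |empProb (fun k => X k ω) n q.1 (ext q.2) - μ.real (cyl q.1 (ext q.2))|} := by
    rintro ω ⟨F, hF, x, hx⟩
    simp only [Set.mem_iUnion]
    refine ⟨(F, fun k => x k), by simpa using hF, ?_⟩
    have hc : cyl F (ext fun k => x k) = cyl F x := cyl_congr fun k hk => by
      have : k ∈ B := hSB F hF hk
      simp [ext, this]
    simpa only [Set.mem_ofPred_eq, empProb, hc] using hx
  calc _ ≤ _ := measureReal_mono hsub (measure_ne_top _ _)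
    _ ≤ _ := measureReal_biUnion_finset_le _ _
    _ ≤ ∑ _q ∈ S ×ˢ (Finset.univ : Finset (B → Spin)),
          2 * Real.exp (n * (p * t ^ 2 - t * δ)) := by
        refine Finset.sum_le_sum fun q hq => ?_
        refine (real_abs_empProb_sub_ge_le hX hlaw hind q.1 _ ht0 ht1 hn).trans ?_
        have := hp q.1 (Finset.mem_product.1 hq).1 (ext q.2)
        gcongr
    _ = _ := by
        rw [Finset.sum_const, Finset.card_product, nsmul_eq_mul, Finset.card_univ,
          Fintype.card_fun, card_spin]
        simp

end IsingNeighborhood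

/-! ### Deterministic bounds for the empirical distance. -/

namespace IsingNeighborhood

variable {d : ℕ}

theorem empProb_nonneg (s : ℕ → Config d) (n : ℕ) (F : Set (Site d)) (x : Config d) :
    0 ≤ empProb s n F x :=
  mul_nonneg (by positivity) (Finset.sum_nonneg fun _ _ => Set.indicator_nonneg (by simp) _)

theorem empProb_anti (s : ℕ → Config d) (n : ℕ) {F G : Set (Site d)} (h : F ⊆ G) (x : Config d) :
    empProb s n G x ≤ empProb s n F x :=
  mul_le_mul_of_nonneg_left (Finset.sum_le_sum fun _ _ =>
    Set.indicator_le_indicator_of_subset (cyl_anti h x) (fun _ => zero_le_one) _) (by positivity)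

theorem empProb_le_one (s : ℕ → Config d) (n : ℕ) (F : Set (Site d)) (x : Config d) :
    empProb s n F x ≤ 1 := by
  have h : ∑ k ∈ Finset.range n, (cyl F x).indicator (fun _ => (1 : ℝ)) (s k) ≤ n := by
    calc _ ≤ ∑ _k ∈ Finset.range n, (1 : ℝ) := Finset.sum_le_sum fun k _ =>
          Set.indicator_le_self' (s := cyl F x) (f := fun _ => (1 : ℝ)) (fun _ _ => zero_le_one) (s k)
      _ = n := by simp
  unfold empProb
  rw [one_div, inv_mul_eq_div]
  exact div_le_one_of_le₀ h (by positivity)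

/-- Replacing `c / e` by `q` in `a - b * (c / e)` costs `(b / e) * |c - q * e|`, and `b / e ≤ 1`.
When `b = 0`, also `a = 0` and the left side vanishes. -/
theorem abs_weighted_ratio_sub_le {a b c e : ℝ} (q : ℝ) (ha : 0 ≤ a) (hab : a ≤ b) (hbe : b ≤ e) :
    |(|a / b - c / e| * b) - (|a - q * b|)| ≤ |c - q * e| := by
  have hb : 0 ≤ b := ha.trans hab
  rcases hb.eq_or_lt with rfl | hb
  · have : a = 0 := le_antisymm hab ha
    simp [this]
  have he : 0 < e := hb.trans_le hbe
  have h1 : |a / b - c / e| * b = |a - b * (c / e)| := by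
    conv_lhs => rw [← abs_of_pos hb, ← abs_mul, abs_of_pos hb]
    congr 1
    field_simp
  rw [h1]
  refine (abs_abs_sub_abs_le_abs_sub _ _).trans ?_
  have h2 : a - b * (c / e) - (a - q * b) = -(b / e) * (c - q * e) := by field_simp; ring
  rw [h2, abs_mul, abs_neg, abs_of_pos (div_pos hb he)]
  exact mul_le_of_le_one_left (abs_nonneg _) ((div_le_one he).2 hbe)

/-- The four blocks whose empirical probabilities enter `empDist`. -/
def blocks [DecidableEq (Set (Site d))] (G : Set (Site d)) (i j : Site d) :
    Finset (Set (Site d)) :=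
  {G, insert i G, insert j G, insert i (insert j G)}

theorem empDist_eq (s : ℕ → Config d) (n : ℕ) {L : ℝ} {i j : Site d}
    (hj : j ∈ box L i) (hij : i ≠ j) (x : Config d) :
    empDist s n L i x j =
      |empProb s n (insert i (insert j (box L i \ {i, j}))) x /
          empProb s n (insert j (box L i \ {i, j})) x -
        empProb s n (insert i (box L i \ {i, j})) x / empProb s n (box L i \ {i, j}) x| *
      empProb s n (insert j (box L i \ {i, j})) x := by
  have h1 : box L i \ {i} = insert j (box L i \ {i, j}) := by
    ext k
    simp only [Set.mem_sdiff, Set.mem_insert_iff, Set.mem_singleton_iff]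
    by_cases hk : k = j
    · subst hk; simp [hj, hij.symm]
    · simp [hk]
  have h2 : (box L i \ {i, j}) \ {i} = box L i \ {i, j} := by
    ext k; simp only [Set.mem_sdiff, Set.mem_insert_iff, Set.mem_singleton_iff]; tauto
  have h3 : (box L i \ {i}) \ {i} = box L i \ {i} := by simp
  unfold empDist empCond
  rw [h3, h2, h1, Set.union_singleton, Set.union_singleton]

theorem abs_empDist_sub_le (s : ℕ → Config d) (n : ℕ) {L : ℝ} {i j : Site d}
    (hj : j ∈ box L i) (hij : i ≠ j) (x : Config d) (q : ℝ) :
    |empDist s n L i x j -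
      (|empProb s n (insert i (insert j (box L i \ {i, j}))) x -
        q * empProb s n (insert j (box L i \ {i, j})) x|)| ≤
      |empProb s n (insert i (box L i \ {i, j})) x - q * empProb s n (box L i \ {i, j}) x| := by
  rw [empDist_eq s n hj hij x]
  exact abs_weighted_ratio_sub_le q (empProb_nonneg _ _ _ _)
    (empProb_anti s n (Set.subset_insert _ _) x) (empProb_anti s n (Set.subset_insert _ _) x)

theorem empDist_le_two (s : ℕ → Config d) (n : ℕ) {L : ℝ} {i j : Site d}
    (hj : j ∈ box L i) (hij : i ≠ j) (x : Config d) : empDist s n L i x j ≤ 2 := by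
  have h := (abs_le.1 (abs_empDist_sub_le s n hj hij x 0)).2
  simp only [zero_mul, sub_zero, abs_of_nonneg (empProb_nonneg s n _ x)] at h
  linarith [empProb_le_one s n (insert i (box L i \ {i, j})) x,
    empProb_le_one s n (insert i (insert j (box L i \ {i, j}))) x]

theorem empDist_self (s : ℕ → Config d) (n : ℕ) (L : ℝ) (i : Site d) (x : Config d) :
    empDist s n L i x i = 0 := by
  simp [empDist]

section Deterministic

variable [DecidableEq (Set (Site d))] {J : Site d → Site d → ℝ} {μ : Measure (Config d)}
  {L δ : ℝ} {i j : Site d} {s : ℕ → Config d} {n : ℕ}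

/-- Each of the two differences involves two frequencies with weights at most `1`, hence an error of
at most `2 * δ` per difference. -/
theorem abs_empDist_sub_population_le (hj : j ∈ box L i) (hij : i ≠ j)
    (hgood : ∀ F ∈ blocks (box L i \ {i, j}) i j, ∀ x,
      |empProb s n F x - μ.real (cyl F x)| ≤ δ) (x : Config d) {q : ℝ} (hq0 : 0 ≤ q)
    (hq1 : q ≤ 1) :
    |empDist s n L i x j - (|μ.real (cyl (insert i (insert j (box L i \ {i, j}))) x) -
        q * μ.real (cyl (insert j (box L i \ {i, j})) x)|)| ≤
      4 * δ + |μ.real (cyl (insert i (box L i \ {i, j})) x) -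
        q * μ.real (cyl (box L i \ {i, j}) x)| := by
  have key : ∀ {a b a' b' : ℝ}, |a - a'| ≤ δ → |b - b'| ≤ δ →
      |(|a - q * b|) - (|a' - q * b'|)| ≤ 2 * δ := fun {a b a' b'} h1 h2 => by
    refine (abs_abs_sub_abs_le_abs_sub _ _).trans ?_
    have h3 : a - q * b - (a' - q * b') = (a - a') - q * (b - b') := by ring
    rw [h3]
    refine (abs_sub _ _).trans ?_
    rw [abs_mul, abs_of_nonneg hq0]
    nlinarith [abs_nonneg (b - b')]
  have h := abs_empDist_sub_le s n hj hij x q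
  have k1 := key (hgood (insert i (insert j (box L i \ {i, j}))) (by simp [blocks]) x)
    (hgood (insert j (box L i \ {i, j})) (by simp [blocks]) x)
  have k2 := key (hgood (insert i (box L i \ {i, j})) (by simp [blocks]) x)
    (hgood (box L i \ {i, j}) (by simp [blocks]) x)
  rw [abs_le] at h k1 k2 ⊢
  constructor <;> linarith

/-- For a site without interaction, the weighted distance is controlled by the sampling error
and the interaction with the sites outside the box. -/
theorem IsIsingLaw.empDist_le (hμ : IsIsingLaw J μ) (hs : Summable fun j => |J i j|)
    (hj : j ∈ box L i) (hij : i ≠ j) (hii : J i i = 0) (hJ : J i j = 0)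
    (hgood : ∀ F ∈ blocks (box L i \ {i, j}) i j, ∀ x,
      |empProb s n F x - μ.real (cyl F x)| ≤ δ) (x : Config d) :
    empDist s n L i x j ≤ 4 * δ + 2 * ∑' k, (box L i)ᶜ.indicator (fun k => |J i k|) k := by
  have := hμ.1
  set θ := ∑' k, (box L i)ᶜ.indicator (fun k => |J i k|) k
  have hθ : 0 ≤ θ := tsum_nonneg fun k => Set.indicator_nonneg (fun _ _ => abs_nonneg _) _
  -- This `q` serves both with and without conditioning on `j`: as `J i j = 0`, the spin at `j` does
  -- not enter the field at `i`.
  have h := (abs_le.1 (abs_empDist_sub_population_le hj hij hgood x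
    (sig_pos (siteField J i (x i) x)).le (sig_lt_one _).le)).2
  have h1 := hμ.abs_real_cyl_insert_sub_le hs (F := insert j (box L i \ {i, j})) (S := (box L i)ᶜ)
    (by simp [hij]) (fun k hk => by
      rw [Set.notMem_compl_iff] at hk
      by_cases h1 : k = i
      · exact Or.inl (h1 ▸ hii)
      · by_cases h2 : k = j <;> simp [h1, h2, hk]) x
  have h2 := hμ.abs_real_cyl_insert_sub_le hs (F := box L i \ {i, j}) (S := (box L i)ᶜ)
    (by simp) (fun k hk => by
      rw [Set.notMem_compl_iff] at hk
      by_cases h1 : k = i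
      · exact Or.inl (h1 ▸ hii)
      · by_cases h2 : k = j
        · exact Or.inl (h2 ▸ hJ)
        · simp [h1, h2, hk]) x
  have e1 : μ.real (cyl (insert j (box L i \ {i, j})) x) ≤ 1 := measureReal_le_one
  have e2 : μ.real (cyl (box L i \ {i, j}) x) ≤ 1 := measureReal_le_one
  nlinarith

end Deterministic

theorem real_cyl_eq_add_flip [DecidableEq (Site d)] (μ : Measure (Config d))
    [IsProbabilityMeasure μ] {j : Site d} {F : Set (Site d)} (hj : j ∉ F) (x : Config d) :
    μ.real (cyl F x) = μ.real (cyl (insert j F) x) +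
      μ.real (cyl (insert j F) (Function.update x j (oppositeSpin (x j)))) := by
  have hc : cyl F (Function.update x j (oppositeSpin (x j))) = cyl F x := cyl_congr fun k hk => by
    rw [Function.update_of_ne]; rintro rfl; exact hj hk
  rw [cyl_insert, cyl_insert, hc, Function.update_self, ← measureReal_union]
  · congr 1
    ext y
    simp only [Set.mem_union, Set.mem_inter_iff, Set.mem_ofPred_eq]
    have := eq_or_eq_flip (x j) (y j)
    tauto
  · rw [Set.disjoint_left]
    rintro y ⟨h1, -⟩ ⟨h2, -⟩
    exact flip_ne (x j) (h2.symm.trans h1)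
  · have := measurableSet_cyl (insert j F) (Function.update x j (oppositeSpin (x j)))
    rwa [cyl_insert, hc, Function.update_self] at this

/-- Pigeonhole one site at a time: one of the two extensions keeps at least half of the mass. -/
theorem exists_le_real_cyl (μ : Measure (Config d)) [IsProbabilityMeasure μ]
    (B : Finset (Site d)) : ∃ x, (1 / 2) ^ B.card ≤ μ.real (cyl (B : Set (Site d)) x) := by
  classical
  induction B using Finset.induction_on with
  | empty => exact ⟨fun _ => ⟨1, by simp⟩, by simp [cyl]⟩
  | insert j B hj ih =>
    obtain ⟨x, hx⟩ := ih
    rw [Finset.card_insert_of_notMem hj, Finset.coe_insert, pow_succ']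
    have h := real_cyl_eq_add_flip μ (F := (B : Set (Site d))) (by simpa using hj) x
    by_cases h1 : 1 / 2 * (1 / 2) ^ B.card ≤ μ.real (cyl (insert j (B : Set (Site d))) x)
    · exact ⟨x, h1⟩
    · exact ⟨Function.update x j (oppositeSpin (x j)), by linarith⟩

section Lower

variable {J : Site d → Site d → ℝ} {μ : Measure (Config d)}
  {i j : Site d}

/-- Flipping an interacting neighbor changes the conditional probabilities at `i`. -/
theorem IsIsingLaw.le_population_dist (hμ : IsIsingLaw J μ) {r κ : ℝ}
    (hs : ∀ i, Summable fun j => |J i j|) (hr : ∀ i, ∑' j, |J i j| ≤ r) {L : ℝ} (hij : i ≠ j)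
    (hii : J i i = 0)
    (x : Config d) (hκ : κ ≤ |sig (siteField J i (x i) x) -
      sig (siteField J i (x i) x - 2 * (J i j * spinVal (x i) * spinVal (x j)))|)
    (hθ : 4 * ∑' k, (box L i)ᶜ.indicator (fun k => |J i k|) k ≤ κ) :
    μ.real (cyl (insert j (box L i \ {i, j})) x) * ((1 - sig r) * (κ / 2)) ≤
      |μ.real (cyl (insert i (insert j (box L i \ {i, j}))) x) -
        μ.real (cyl (insert i (box L i \ {i, j})) x) / μ.real (cyl (box L i \ {i, j}) x) *
          μ.real (cyl (insert j (box L i \ {i, j})) x)| := by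
  classical
  have := hμ.1
  set θ := ∑' k, (box L i)ᶜ.indicator (fun k => |J i k|) k
  set x' := Function.update x j (oppositeSpin (x j)) with hx'
  set G := box L i \ {i, j} with hG
  have hjG : j ∉ G := by simp [hG]
  have hx'i : x' i = x i := Function.update_of_ne hij _ _
  have hcG : cyl G x' = cyl G x := cyl_congr fun k hk => by
    rw [hx', Function.update_of_ne]; rintro rfl; exact hjG hk
  have e1 := real_cyl_eq_add_flip μ hjG x
  have e2 := real_cyl_eq_add_flip μ (j := j) (F := insert i G) (by simp [hij.symm, hjG]) x
  rw [Set.insert_comm j i] at e2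
  have hF : ∀ k, k ∉ (box L i)ᶜ → J i k = 0 ∨ k ∈ insert j G := fun k hk => by
    rw [Set.notMem_compl_iff] at hk
    by_cases h1 : k = i
    · exact Or.inl (h1 ▸ hii)
    · by_cases h2 : k = j <;> simp [hG, h1, h2, hk]
  have hiF : i ∉ insert j G := by simp [hG, hij]
  have b1 := hμ.abs_real_cyl_insert_sub_le (hs i) hiF hF x
  have b2 := hμ.abs_real_cyl_insert_sub_le (hs i) hiF hF x'
  rw [hx'i, hx', siteField_update_flip (hs i), ← hx'] at b2
  have b3 := hμ.le_real_cyl_insert_sig hs hr hjG x'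
  rw [hcG] at b3
  rw [← hx'] at e1 e2
  have hu0 : 0 ≤ μ.real (cyl (insert j G) x) := measureReal_nonneg
  have hu0' : 0 ≤ μ.real (cyl (insert j G) x') := measureReal_nonneg
  set σ := sig (siteField J i (x i) x)
  set σ' := sig (siteField J i (x i) x - 2 * (J i j * spinVal (x i) * spinVal (x j)))
  set u := μ.real (cyl (insert j G) x)
  set u' := μ.real (cyl (insert j G) x')
  set v := μ.real (cyl (insert i (insert j G)) x)
  set v' := μ.real (cyl (insert i (insert j G)) x')
  rw [e2, e1]
  rw [e1] at b3
  rcases hu0.eq_or_lt with h0 | h0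
  · rw [← h0]; simp
  have he : 0 < u + u' := by linarith
  -- The difference becomes a determinant. Since `v ≈ σ * u` and `v' ≈ σ' * u'` within relative
  -- error `θ`, it is close to `(σ - σ') * u * u'`, and `4 * θ ≤ κ` leaves at least `κ / 2 * u *
  -- u'`. Finally `u' / (u + u') ≥ 1 - sig r`.
  have h1 : v - (v + v') / (u + u') * u = (v * u' - u * v') / (u + u') := by
    field_simp; ring
  rw [h1, abs_div, abs_of_pos he, le_div_iff₀ he]
  have hθ0 : 0 ≤ θ := tsum_nonneg fun k => Set.indicator_nonneg (fun _ _ => abs_nonneg _) _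
  have h2 : |(σ - σ') * (u * u')| ≤ |v * u' - u * v'| + θ * u * u' + u * (θ * u') := by
    have : (σ - σ') * (u * u') =
        (v * u' - u * v') - (v - σ * u) * u' + u * (v' - σ' * u') := by ring
    rw [this]
    refine (abs_add_le _ _).trans (add_le_add ((abs_sub _ _).trans (add_le_add le_rfl ?_)) ?_)
    · rw [abs_mul, abs_of_nonneg hu0']
      exact mul_le_mul_of_nonneg_right b1 hu0'
    · rw [abs_mul, abs_of_nonneg hu0]
      exact mul_le_mul_of_nonneg_left b2 hu0
  rw [abs_mul, abs_of_nonneg (mul_nonneg hu0 hu0')] at h2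
  have h3 : κ * (u * u') ≤ |σ - σ'| * (u * u') := by gcongr
  have h4 : θ * (u * u') ≤ κ / 4 * (u * u') :=
    mul_le_mul_of_nonneg_right (by linarith) (mul_nonneg hu0 hu0')
  have h5 : (u * (κ / 2)) * ((1 - sig r) * (u + u')) ≤ (u * (κ / 2)) * u' :=
    mul_le_mul_of_nonneg_left b3 (mul_nonneg hu0 (by linarith))
  nlinarith

/-- For an interacting site, some configuration makes the weighted distance large whenever the
sampling error is small. -/
theorem IsIsingLaw.exists_le_empDist [DecidableEq (Set (Site d))] (hμ : IsIsingLaw J μ) {r κ δ L : ℝ}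
    (hs : ∀ i, Summable fun j => |J i j|) (hr : ∀ i, ∑' j, |J i j| ≤ r) (hij : i ≠ j)
    (hj : j ∈ box L i) (hii : J i i = 0)
    (hκ : ∀ x : Config d, κ ≤ |sig (siteField J i (x i) x) -
      sig (siteField J i (x i) x - 2 * (J i j * spinVal (x i) * spinVal (x j)))|)
    (hκ0 : 0 ≤ κ) (hθ : 4 * ∑' k, (box L i)ᶜ.indicator (fun k => |J i k|) k ≤ κ)
    {B : Finset (Site d)} (hB : (B : Set (Site d)) = box L i)
    {s : ℕ → Config d} {n : ℕ} (hgood : ∀ F ∈ blocks (box L i \ {i, j}) i j, ∀ x,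
      |empProb s n F x - μ.real (cyl F x)| ≤ δ) :
    ∃ x, (1 / 2) ^ B.card * ((1 - sig r) * (κ / 2)) - 4 * δ ≤ empDist s n L i x j := by
  have := hμ.1
  obtain ⟨x, hx⟩ := exists_le_real_cyl μ B
  refine ⟨x, ?_⟩
  have h1 := hμ.le_population_dist hs hr (L := L) hij hii x (hκ x) hθ
  have hanti : μ.real (cyl (insert i (box L i \ {i, j})) x) ≤
      μ.real (cyl (box L i \ {i, j}) x) := measureReal_mono (cyl_anti (Set.subset_insert _ _) x)
  -- With `q` the true conditional probability given the block without `j`, the bias term vanishes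
  -- identically, also when the denominator is zero.
  have h2 := (abs_le.1 (abs_empDist_sub_population_le hj hij hgood x
    (q := μ.real (cyl (insert i (box L i \ {i, j})) x) / μ.real (cyl (box L i \ {i, j}) x))
    (by positivity) (div_le_one_of_le₀ hanti measureReal_nonneg))).1
  have h3 : μ.real (cyl (insert i (box L i \ {i, j})) x) -
      μ.real (cyl (insert i (box L i \ {i, j})) x) / μ.real (cyl (box L i \ {i, j}) x) *
        μ.real (cyl (box L i \ {i, j}) x) = 0 := by
    by_cases h : μ.real (cyl (box L i \ {i, j}) x) = 0
    · rw [h] at hanti ⊢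
      have := le_antisymm hanti measureReal_nonneg
      rw [this]
      simp
    · rw [div_mul_cancel₀ _ h, sub_self]
  rw [h3, abs_zero] at h2
  have h4 : (1 / 2) ^ B.card ≤ μ.real (cyl (insert j (box L i \ {i, j})) x) := by
    refine hx.trans (measureReal_mono (cyl_anti ?_ x))
    rw [hB]
    exact Set.insert_subset hj Set.sdiff_subset
  have h5 : 0 ≤ (1 - sig r) * (κ / 2) :=
    mul_nonneg (by linarith [sig_lt_one r]) (by linarith)
  have h6 := mul_le_mul_of_nonneg_right h4 h5
  linarith

end Lower

end IsingNeighborhood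

/-! ### Exponential rates on the scale `0.79 log n`. -/

namespace IsingNeighborhood

theorem tendsto_exp_mul_of_neg {m e : ℕ → ℝ} {l : ℝ} (hm : Tendsto m atTop atTop)
    (he : Tendsto e atTop (𝓝 l)) (hl : l < 0) :
    Tendsto (fun n => Real.exp (m n * e n)) atTop (𝓝 0) :=
  Real.tendsto_exp_atBot.comp (hm.atTop_mul_neg hl he)

/-- The volume scale `0.79 log n = (2 L_n)^d`. -/
noncomputable def volScale (n : ℕ) : ℝ := 0.79 * Real.log n

theorem tendsto_volScale : Tendsto volScale atTop atTop :=
  (Real.tendsto_log_atTop.comp tendsto_natCast_atTop_atTop).const_mul_atTop (by norm_num)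

theorem volScale_nonneg (n : ℕ) : 0 ≤ volScale n :=
  mul_nonneg (by norm_num) (Real.log_natCast_nonneg n)

theorem exp_volScale {n : ℕ} (hn : 0 < n) : Real.exp (volScale n * (1 / 0.79)) = n := by
  rw [volScale, show (0.79 : ℝ) * Real.log n * (1 / 0.79) = Real.log n by ring,
    Real.exp_log (by exact_mod_cast hn)]

section Radius

variable {d : ℕ}

theorem radius_nonneg (d n : ℕ) : 0 ≤ radius d n :=
  mul_nonneg (by norm_num) (Real.rpow_nonneg (volScale_nonneg n) _)

theorem two_mul_radius_pow (hd : 1 ≤ d) (n : ℕ) : (2 * radius d n) ^ d = volScale n := by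
  have h : 2 * radius d n = volScale n ^ ((d : ℝ)⁻¹) := by
    rw [radius, volScale]; ring_nf
  rw [h, Real.rpow_inv_natCast_pow (volScale_nonneg n) (by omega)]

theorem tendsto_radius (hd : 1 ≤ d) : Tendsto (radius d) atTop atTop := by
  have : (0 : ℝ) < 1 / d := by positivity
  exact ((tendsto_rpow_atTop this).comp tendsto_volScale).const_mul_atTop (by norm_num)

theorem tendsto_pow_div_volScale (hd : 1 ≤ d) {u : ℕ → ℝ}
    (hu : Tendsto (fun n => u n / radius d n) atTop (𝓝 2)) :
    Tendsto (fun n => u n ^ d / volScale n) atTop (𝓝 1) := by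
  have h := (hu.div_const 2).pow d
  rw [div_self two_ne_zero, one_pow] at h
  refine h.congr fun n => ?_
  rw [← two_mul_radius_pow hd, ← div_pow, div_div, mul_comm]

theorem tendsto_floor_radius (hd : 1 ≤ d) :
    Tendsto (fun n => (⌊radius d n⌋₊ : ℝ) / radius d n) atTop (𝓝 1) :=
  tendsto_nat_floor_div_atTop.comp (tendsto_radius hd)

theorem tendsto_inner_volume (hd : 1 ≤ d) :
    Tendsto (fun n => (2 * (⌊radius d n⌋₊ : ℝ)) ^ d / volScale n) atTop (𝓝 1) := by
  refine tendsto_pow_div_volScale hd ?_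
  have h := (tendsto_floor_radius hd).const_mul 2
  rw [mul_one] at h
  exact h.congr fun n => by ring

theorem tendsto_box_volume (hd : 1 ≤ d) :
    Tendsto (fun n => (2 * (⌊radius d n⌋₊ : ℝ) + 1) ^ d / volScale n) atTop (𝓝 1) := by
  refine tendsto_pow_div_volScale hd ?_
  have h := ((tendsto_floor_radius hd).const_mul 2).add
    (tendsto_inv_atTop_zero.comp (tendsto_radius hd))
  rw [mul_one, add_zero] at h
  exact h.congr fun n => by simp only [Function.comp_apply]; ring

end Radius

/-- The exponential rate of decay of the threshold on the volume scale. -/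
noncomputable def thresholdRate : ℝ := (1 / 0.79 - Real.log (sig 1)) / 2

theorem neg_log_sig_one : -Real.log (sig 1) = Real.log (1 + Real.exp (-2)) := by
  rw [sig, one_div, Real.log_inv, neg_neg, mul_one]

theorem exp_neg_two_lower : (0.135 : ℝ) < Real.exp (-2) := by
  have h := Real.exp_one_lt_d9
  have h2 : Real.exp 2 = Real.exp 1 ^ 2 := by rw [← Real.exp_nat_mul]; norm_num
  have h3 : Real.exp 2 < 7.4 := by
    rw [h2]; nlinarith [Real.exp_pos 1]
  rw [Real.exp_neg, lt_inv_comm₀ (by norm_num) (Real.exp_pos _)]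
  linarith [show (7.4 : ℝ) < 0.135⁻¹ by norm_num]

theorem neg_log_sig_one_lt : -Real.log (sig 1) < 0.5 := by
  rw [neg_log_sig_one]
  have h1 := Real.log_le_sub_one_of_pos (show 0 < 1 + Real.exp (-2) by positivity)
  have h2 : Real.exp (-2) < 0.5 := by
    rw [Real.exp_neg, inv_lt_comm₀ (Real.exp_pos _) (by norm_num)]
    have := Real.add_one_lt_exp (show (2 : ℝ) ≠ 0 by norm_num)
    norm_num
    linarith
  linarith

/-- This inequality limits the constant `0.79`: it requires `1 / 0.79 > 2 log 2 - log (1 + exp (-2))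
≈ 1.2594`, and `1 / 0.79 ≈ 1.2658`. The margin is small, hence the sharp numerical bounds. -/
theorem log_two_lt_thresholdRate : Real.log 2 < thresholdRate := by
  have h1 := Real.log_two_lt_d9
  have h2 := Real.le_log_one_add_of_nonneg (Real.exp_pos (-2)).le
  have h3 := exp_neg_two_lower
  have h4 : (0.126 : ℝ) ≤ 2 * Real.exp (-2) / (Real.exp (-2) + 2) := by
    rw [le_div_iff₀ (by positivity)]; linarith
  rw [thresholdRate, sub_eq_add_neg, neg_log_sig_one]
  norm_num at *
  linarith

theorem thresholdRate_lt_one : thresholdRate < 1 := by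
  have := neg_log_sig_one_lt
  rw [thresholdRate]
  norm_num at *
  linarith

theorem base_eq_inv_sig_one : (1 + Real.exp 2) / Real.exp 2 = (sig 1)⁻¹ := by
  rw [sig, one_div, inv_inv, mul_one, Real.exp_neg]
  field_simp
  ring

variable {d : ℕ} {C : ℝ}

theorem threshold_eq (hd : 1 ≤ d) {n : ℕ} :
    threshold d C (radius d n) n =
      C * √(volScale n / n * Real.exp (volScale n * Real.log (sig 1))) := by
  rw [threshold, two_mul_radius_pow hd, base_eq_inv_sig_one,
    Real.rpow_def_of_pos (inv_pos.2 (sig_pos 1)), Real.log_inv]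
  ring_nf

theorem mul_threshold_sq (hd : 1 ≤ d) {n : ℕ} (hn : 0 < n) :
    n * threshold d C (radius d n) n ^ 2 =
      C ^ 2 * volScale n * Real.exp (volScale n * Real.log (sig 1)) := by
  have hn' : (0 : ℝ) < n := by exact_mod_cast hn
  have := volScale_nonneg n
  rw [threshold_eq hd, mul_pow, Real.sq_sqrt (by positivity)]
  field_simp

/-- The factors `C` and `√m` contribute only `log C / m + log m / (2 m)` to the exponent, which
tends to zero. -/
theorem exists_threshold_exponent (hd : 1 ≤ d) (hC : 0 < C) :
    ∃ e : ℕ → ℝ, Tendsto e atTop (𝓝 (-thresholdRate)) ∧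
      ∀ᶠ n in atTop, threshold d C (radius d n) n = Real.exp (volScale n * e n) := by
  refine ⟨fun n => -thresholdRate + (Real.log C / volScale n +
    Real.log (volScale n) / volScale n / 2), ?_, ?_⟩
  · have h1 : Tendsto (fun n => Real.log C / volScale n) atTop (𝓝 0) :=
      tendsto_const_nhds.div_atTop tendsto_volScale
    have h2 : Tendsto (fun n => Real.log (volScale n) / volScale n) atTop (𝓝 0) :=
      Real.isLittleO_log_id_atTop.tendsto_div_nhds_zero.comp tendsto_volScale
    have h3 := (h1.add (h2.div_const 2)).const_add (-thresholdRate)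
    simpa using h3
  · filter_upwards [tendsto_volScale.eventually_gt_atTop 0, eventually_gt_atTop 0] with n hm hn
    rw [threshold_eq hd]
    have hx : 0 < volScale n / n * Real.exp (volScale n * Real.log (sig 1)) := by positivity
    rw [Real.sqrt_eq_rpow, Real.rpow_def_of_pos hx, Real.log_mul (by positivity) (by positivity),
      Real.log_exp, Real.log_div hm.ne' (by positivity)]
    nth_rewrite 1 [← Real.exp_log hC]
    rw [← Real.exp_add]
    congr 1
    have hl : Real.log n = volScale n * (1 / 0.79) := by rw [volScale]; ring
    rw [hl, thresholdRate]
    field_simp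
    ring

/-- The choice of the Chernoff parameter is admissible for large samples. -/
theorem eventually_mul_volScale_le_mul_threshold (hd : 1 ≤ d) (hC : 0 < C) (K : ℝ) :
    ∀ᶠ n : ℕ in atTop, K * volScale n ≤ n * threshold d C (radius d n) n := by
  obtain ⟨e, he, heq⟩ := exists_threshold_exponent (C := C) hd hC
  have h2 : Tendsto (fun n => Real.log (volScale n) / volScale n) atTop (𝓝 0) :=
    Real.isLittleO_log_id_atTop.tendsto_div_nhds_zero.comp tendsto_volScale
  have h3 := ((h2.sub he).sub_const (1 / 0.79))
  -- As `n = exp (m / 0.79)`, the product `n * ε` grows at rate `1 / 0.79 - thresholdRate > 0` and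
  -- outgrows `m`.
  have hneg : 0 - -thresholdRate - 1 / 0.79 < 0 := by
    have := thresholdRate_lt_one
    norm_num at *
    linarith
  have h4 := (tendsto_exp_mul_of_neg tendsto_volScale h3 hneg).const_mul K
  rw [mul_zero] at h4
  filter_upwards [h4.eventually_lt_const one_pos, heq, tendsto_volScale.eventually_gt_atTop 0,
    eventually_gt_atTop 0] with n h heq hm hn
  rw [heq]
  nth_rewrite 1 [← exp_volScale hn]
  rw [← Real.exp_add]
  have h5 : volScale n * (Real.log (volScale n) / volScale n - e n - 1 / 0.79) =
      Real.log (volScale n) - (volScale n * (1 / 0.79) + volScale n * e n) := by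
    field_simp
    ring
  rw [h5, Real.exp_sub, Real.exp_log hm, ← mul_div_assoc, div_lt_one (Real.exp_pos _)] at h
  exact h.le

theorem tendsto_exp_neg_div_threshold (hd : 1 ≤ d) (hC : 0 < C) :
    Tendsto (fun n => Real.exp (-(2 * (⌊radius d n⌋₊ : ℝ)) ^ d) / threshold d C (radius d n) n)
      atTop (𝓝 0) := by
  obtain ⟨e, he, heq⟩ := exists_threshold_exponent (C := C) hd hC
  have h := tendsto_exp_mul_of_neg tendsto_volScale ((tendsto_inner_volume hd).neg.sub he)
    (by linarith [thresholdRate_lt_one])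
  refine h.congr' ?_
  filter_upwards [heq, tendsto_volScale.eventually_gt_atTop 0] with n heq hm
  rw [heq, ← Real.exp_sub]
  congr 1
  field_simp

theorem pow_eq_exp_volScale {a : ℝ} (ha : 0 < a) {n M : ℕ} (hm : 0 < volScale n) :
    a ^ M = Real.exp (volScale n * (M / volScale n * Real.log a)) := by
  rw [← Real.rpow_natCast, Real.rpow_def_of_pos ha]
  congr 1
  field_simp

variable {M : ℕ → ℕ}

theorem tendsto_threshold_mul_two_pow
    (hM : Tendsto (fun n => (M n : ℝ) / volScale n) atTop (𝓝 1)) (hd : 1 ≤ d)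
    (hC : 0 < C) :
    Tendsto (fun n => threshold d C (radius d n) n * 2 ^ M n) atTop (𝓝 0) := by
  obtain ⟨e, he, heq⟩ := exists_threshold_exponent (C := C) hd hC
  have h := tendsto_exp_mul_of_neg tendsto_volScale (he.add (hM.mul_const (Real.log 2)))
    (by linarith [log_two_lt_thresholdRate])
  refine h.congr' ?_
  filter_upwards [heq, tendsto_volScale.eventually_gt_atTop 0] with n heq hm
  rw [heq, pow_eq_exp_volScale two_pos hm, ← Real.exp_add, mul_add]

/-- The union bound over patterns costs rate `log 2`, less than the rate `2` that the Chernoff bound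
supplies. -/
theorem tendsto_two_pow_mul_exp
    (hM : Tendsto (fun n => (M n : ℝ) / volScale n) atTop (𝓝 1)) :
    Tendsto (fun n => 2 ^ M n * Real.exp (-2 * volScale n)) atTop (𝓝 0) := by
  have h := tendsto_exp_mul_of_neg tendsto_volScale ((hM.mul_const (Real.log 2)).sub_const 2)
    (by linarith [Real.log_two_lt_d9])
  refine h.congr' ?_
  filter_upwards [tendsto_volScale.eventually_gt_atTop 0] with n hm
  rw [pow_eq_exp_volScale two_pos hm, ← Real.exp_add]
  ring_nf

/-- The strict inequality `sig r < sig 1` gives an exponential gain that absorbs `K` and the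
discrepancy between `M n` and `m`, for any `C > 0`. -/
theorem eventually_pow_mul_volScale_le
    (hM : Tendsto (fun n => (M n : ℝ) / volScale n) atTop (𝓝 1)) (hd : 1 ≤ d)
    (hC : 0 < C) {r : ℝ} (hr : r < 1) (K : ℝ) :
    ∀ᶠ n : ℕ in atTop,
      K * sig r ^ M n * volScale n ≤ n * threshold d C (radius d n) n ^ 2 := by
  have hlog : Real.log (sig r) < Real.log (sig 1) :=
    Real.log_lt_log (sig_pos r) (sig_strictMono hr)
  have h := (tendsto_exp_mul_of_neg tendsto_volScale
    ((hM.mul_const (Real.log (sig r))).sub_const (Real.log (sig 1))) (by linarith)).const_mul K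
  rw [mul_zero] at h
  filter_upwards [h.eventually_lt_const (show 0 < C ^ 2 by positivity),
    tendsto_volScale.eventually_gt_atTop 0, eventually_gt_atTop 0] with n h hm hn
  rw [mul_threshold_sq hd hn, pow_eq_exp_volScale (sig_pos r) hm]
  rw [mul_sub, Real.exp_sub, ← mul_div_assoc, div_lt_iff₀ (Real.exp_pos _)] at h
  nlinarith

end IsingNeighborhood

/-! ### Boxes and the interaction outside them. -/

namespace IsingNeighborhood

variable {d : ℕ}

theorem mem_box_iff {L : ℝ} (hL : 0 ≤ L) (i j : Site d) :
    j ∈ box L i ↔ ∀ k, |i k - j k| ≤ (⌊L⌋₊ : ℤ) := by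
  simp only [box, Set.mem_ofPred_eq]
  rw [pi_norm_le_iff_of_nonneg hL]
  refine forall_congr' fun k => ?_
  rw [Pi.sub_apply, Int.norm_eq_abs, Int.abs_eq_natAbs, Nat.cast_le, Nat.le_floor_iff hL,
    ← Int.cast_abs, Int.abs_eq_natAbs, Int.cast_natCast]

theorem box_floor {L : ℝ} (hL : 0 ≤ L) (i : Site d) : box (⌊L⌋₊ : ℝ) i = box L i := by
  ext j
  rw [mem_box_iff (Nat.cast_nonneg _), mem_box_iff hL, Nat.floor_natCast]

theorem self_mem_box {L : ℝ} (hL : 0 ≤ L) (i : Site d) : i ∈ box L i := by simp [box, hL]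

/-- The box of radius `N` around `i` as a finite set. -/
noncomputable def boxFinset (N : ℕ) (i : Site d) : Finset (Site d) :=
  Finset.Icc (fun k => i k - N) (fun k => i k + N)

theorem coe_boxFinset {L : ℝ} (hL : 0 ≤ L) (i : Site d) :
    (boxFinset ⌊L⌋₊ i : Set (Site d)) = box L i := by
  ext j
  rw [mem_box_iff hL, boxFinset, Finset.coe_Icc, Set.mem_Icc, Pi.le_def, Pi.le_def,
    ← forall_and]
  refine forall_congr' fun k => ?_
  rw [abs_le]
  constructor <;> rintro ⟨h1, h2⟩ <;> constructor <;> linarith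

theorem card_boxFinset (N : ℕ) (i : Site d) : (boxFinset N i).card = (2 * N + 1) ^ d := by
  rw [boxFinset, Pi.card_Icc]
  have : ∀ k, (Finset.Icc (i k - N) (i k + N)).card = 2 * N + 1 := fun k => by
    rw [Int.card_Icc]; omega
  simp [this]

section Potential

variable {J : Site d → Site d → ℝ}

theorem summable_abs_of_iSup_lt (hr : (⨆ i, ∑' j, ENNReal.ofReal |J i j|) < 1) (i : Site d) :
    Summable fun j => |J i j| := by
  have h : ∑' j, ENNReal.ofReal |J i j| ≠ ∞ :=
    (((le_iSup (fun i => ∑' j, ENNReal.ofReal |J i j|) i).trans_lt hr).trans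
      ENNReal.one_lt_top).ne
  simpa [ENNReal.toReal_ofReal (abs_nonneg _)] using ENNReal.summable_toReal h

theorem exists_uniform_bound (hr : (⨆ i, ∑' j, ENNReal.ofReal |J i j|) < 1) :
    ∃ r < 1, ∀ i, ∑' j, |J i j| ≤ r := by
  refine ⟨(⨆ i, ∑' j, ENNReal.ofReal |J i j|).toReal, ?_, fun i => ?_⟩
  · rw [← ENNReal.toReal_one]
    exact (ENNReal.toReal_lt_toReal (hr.trans ENNReal.one_lt_top).ne ENNReal.one_ne_top).2 hr
  · rw [← ENNReal.ofReal_le_iff_le_toReal (hr.trans ENNReal.one_lt_top).ne,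
      ENNReal.ofReal_tsum_of_nonneg (fun _ => abs_nonneg _) (summable_abs_of_iSup_lt hr i)]
    exact le_iSup (fun i => ∑' j, ENNReal.ofReal |J i j|) i

theorem tsum_outside_box_le {N : ℕ} {i : Site d} (hs : Summable fun j => |J i j|) {E : ℝ}
    (hE : 0 < E)
    (h : ∑' j : {j : Site d // (N : ℝ) < ‖j - i‖}, ENNReal.ofReal (|J i j| * E) ≤ 1) :
    ∑' k, (box (N : ℝ) i)ᶜ.indicator (fun k => |J i k|) k ≤ E⁻¹ := by
  have hset : (box (N : ℝ) i)ᶜ = {j : Site d | (N : ℝ) < ‖j - i‖} := by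
    ext j
    simp [box, norm_sub_rev i j]
  rw [← one_div, le_div_iff₀ hE, ← tsum_mul_right, ← ENNReal.ofReal_le_one,
    ENNReal.ofReal_tsum_of_nonneg
      (fun k => mul_nonneg (Set.indicator_nonneg (fun _ _ => abs_nonneg _) _) hE.le)
      ((hs.indicator _).mul_right E)]
  refine le_trans (le_of_eq ?_) h
  rw [show (∑' j : {j : Site d // (N : ℝ) < ‖j - i‖}, ENNReal.ofReal (|J i j| * E)) =
    ∑' k, ({j : Site d | (N : ℝ) < ‖j - i‖}).indicator
      (fun k => ENNReal.ofReal (|J i k| * E)) k from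
        tsum_subtype {j : Site d | (N : ℝ) < ‖j - i‖} fun k => ENNReal.ofReal (|J i k| * E)]
  refine tsum_congr fun k => ?_
  rw [hset]
  by_cases hk : k ∈ {j : Site d | (N : ℝ) < ‖j - i‖}
  · rw [Set.indicator_of_mem hk, Set.indicator_of_mem hk]
  · rw [Set.indicator_of_notMem hk, Set.indicator_of_notMem hk]; simp

theorem eventually_tail_le (hd : 1 ≤ d) (hs : ∀ i, Summable fun j => |J i j|)
    (htail : Tendsto
      (fun L : ℕ => ⨆ i : Site d, ∑' j : {j : Site d // (L : ℝ) < ‖j - i‖},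
        ENNReal.ofReal (|J i j| * Real.exp ((2 * (L : ℝ)) ^ d)))
      atTop (𝓝 0)) (i : Site d) :
    ∀ᶠ n in atTop, ∑' k, (box (radius d n) i)ᶜ.indicator (fun k => |J i k|) k ≤
      Real.exp (-(2 * (⌊radius d n⌋₊ : ℝ)) ^ d) := by
  have hfl : Tendsto (fun n => ⌊radius d n⌋₊) atTop atTop :=
    tendsto_nat_floor_atTop.comp (tendsto_radius hd)
  -- The tail condition runs over integer radii, and the box of radius `L_n` is that of radius
  -- `⌊L_n⌋₊`. Only an eventual bound by `1` is needed from the limit.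
  filter_upwards [hfl.eventually (htail.eventually_le_const zero_lt_one)] with n hn
  rw [← box_floor (radius_nonneg d n), Real.exp_neg]
  exact tsum_outside_box_le (hs i) (Real.exp_pos _) ((le_iSup (fun i : Site d =>
    ∑' j : {j : Site d // ((⌊radius d n⌋₊ : ℕ) : ℝ) < ‖j - i‖},
      ENNReal.ofReal (|J i j| * Real.exp ((2 * ((⌊radius d n⌋₊ : ℕ) : ℝ)) ^ d))) i).trans hn)

end Potential

theorem tendsto_card_box (hd : 1 ≤ d) (i : Site d) :
    Tendsto (fun n => ((boxFinset ⌊radius d n⌋₊ i).card : ℝ) / volScale n) atTop (𝓝 1) := by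
  refine (tendsto_box_volume hd).congr fun n => ?_
  rw [card_boxFinset]
  push_cast
  rfl

theorem eventually_mem_box (hd : 1 ≤ d) (i j : Site d) : ∀ᶠ n in atTop, j ∈ box (radius d n) i :=
  (tendsto_radius hd).eventually_ge_atTop _

theorem threshold_nonneg {C : ℝ} (hC : 0 ≤ C) (L : ℝ) (n : ℕ) : 0 ≤ threshold d C L n :=
  mul_nonneg hC (Real.sqrt_nonneg _)

/-! ### The high-probability event. -/

section Probability

variable {Ω : Type*} [MeasurableSpace Ω] {P : Measure Ω} [IsProbabilityMeasure P]

theorem tendsto_measure_one_of_compl_subset {S T : ℕ → Set Ω}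
    (hST : ∀ᶠ n in atTop, (T n)ᶜ ⊆ S n)
    (hT : Tendsto (fun n => P.real (T n)) atTop (𝓝 0)) :
    Tendsto (fun n => P (S n)) atTop (𝓝 1) := by
  have hT' : Tendsto (fun n => P (T n)) atTop (𝓝 0) := by
    have := ENNReal.tendsto_ofReal hT
    simpa [ofReal_measureReal] using this
  have hlow : Tendsto (fun n => 1 - P (T n)) atTop (𝓝 1) := by
    have := ENNReal.Tendsto.sub (tendsto_const_nhds (x := (1 : ℝ≥0∞))) hT'
      (Or.inl ENNReal.one_ne_top)
    simpa using this
  refine tendsto_of_tendsto_of_tendsto_of_le_of_le' hlow tendsto_const_nhds ?_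
    (Eventually.of_forall fun n => prob_le_one)
  filter_upwards [hST] with n hn
  rw [tsub_le_iff_right, ← measure_univ (μ := P)]
  refine (measure_mono fun ω _ => ?_).trans (measure_union_le (S n) (T n))
  by_cases h : ω ∈ T n
  · exact Or.inr h
  · exact Or.inl (hn h)

variable {J : Site d → Site d → ℝ} {μ : Measure (Config d)} {X : ℕ → Ω → Config d}

/-- With probability tending to one, the empirical probabilities of all relevant blocks are within
a small multiple of the threshold of their expectations. -/
theorem IsIsingLaw.tendsto_real_deviation [DecidableEq (Set (Site d))] (hμ : IsIsingLaw J μ)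
    (hd : 1 ≤ d) {r : ℝ} (hs : ∀ i, Summable fun j => |J i j|) (hr : ∀ i, ∑' j, |J i j| ≤ r)
    (hr1 : r < 1) (hX : ∀ k, Measurable (X k)) (hlaw : ∀ k, P.map (X k) = μ)
    (hind : iIndepFun X P) {C : ℝ} (hC : 0 < C) {i j : Site d} (hij : i ≠ j) :
    Tendsto (fun n => P.real {ω | ∃ F ∈ blocks (box (radius d n) i \ {i, j}) i j, ∃ x,
      threshold d C (radius d n) n / 16 ≤
        |empProb (fun k => X k ω) n F x - μ.real (cyl F x)|}) atTop (𝓝 0) := by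
  classical
  have := hμ.1
  have hM := tendsto_card_box hd i
  have hlim := (tendsto_two_pow_mul_exp hM).const_mul 8
  rw [mul_zero] at hlim
  refine squeeze_zero' (Eventually.of_forall fun n => measureReal_nonneg) ?_ hlim
  filter_upwards [eventually_mem_box hd i j, eventually_gt_atTop 0,
    tendsto_volScale.eventually_gt_atTop 0,
    eventually_mul_volScale_le_mul_threshold hd hC 64,
    eventually_pow_mul_volScale_le hM hd hC hr1 (2048 / sig r ^ 2)] with n hj hn hm ht hp
  set B := boxFinset ⌊radius d n⌋₊ i
  set ε := threshold d C (radius d n) n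
  set m := volScale n
  have hL := radius_nonneg d n
  have hB : (B : Set (Site d)) = box (radius d n) i := coe_boxFinset hL i
  have hi := self_mem_box hL i
  have hn' : (0 : ℝ) < n := by exact_mod_cast hn
  have hnε : 0 < n * ε := lt_of_lt_of_le (by positivity) ht
  have hε : 0 < ε := pos_of_mul_pos_right hnε hn'.le
  have hρ := sig_pos r
  have hcard : (B \ {i, j}).card + 2 = B.card := by
    rw [Finset.card_sdiff_of_subset, Finset.card_pair hij]
    · have : ({i, j} : Finset (Site d)).card ≤ B.card := Finset.card_le_card (by
        rw [← Finset.coe_subset, hB]; simp [Set.insert_subset_iff, hi, hj])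
      rw [Finset.card_pair hij] at this
      omega
    · rw [← Finset.coe_subset, hB]; simp [Set.insert_subset_iff, hi, hj]
  -- Every block contains the box minus two sites, hence the loss `sig r ^ 2`.
  have hpF : ∀ F ∈ blocks (box (radius d n) i \ {i, j}) i j, ∀ x,
      μ.real (cyl F x) ≤ sig r ^ B.card / sig r ^ 2 := fun F hF x => by
    have hsub : box (radius d n) i \ {i, j} ⊆ F := by
      simp only [blocks, Finset.mem_insert, Finset.mem_singleton] at hF
      rcases hF with rfl | rfl | rfl | rfl
      · exact subset_rfl
      · exact Set.subset_insert _ _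
      · exact Set.subset_insert _ _
      · exact (Set.subset_insert _ _).trans (Set.subset_insert _ _)
    have h1 := hμ.real_cyl_le_pow hs hr (B \ {i, j}) x
    rw [Finset.coe_sdiff, hB, Finset.coe_pair] at h1
    refine (measureReal_mono (cyl_anti hsub x)).trans (h1.trans (le_of_eq ?_))
    rw [← hcard, pow_add, mul_div_cancel_right₀ _ (by positivity)]
  have hFB : ∀ F ∈ blocks (box (radius d n) i \ {i, j}) i j, F ⊆ (B : Set (Site d)) :=
    fun F hF => by
      simp only [blocks, Finset.mem_insert, Finset.mem_singleton] at hF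
      rw [hB]
      rcases hF with rfl | rfl | rfl | rfl <;>
        simp only [Set.insert_subset_iff, hi, hj, true_and, Set.sdiff_subset]
  have hbound := real_exists_abs_empProb_sub_ge_le hX hlaw hind B _ hFB hpF
    (t := 64 * m / (n * ε)) (δ := ε / 16) (by positivity) ((div_le_one hnε).2 ht) hn
  refine hbound.trans ?_
  have hSc : ((blocks (box (radius d n) i \ {i, j}) i j).card : ℝ) ≤ 4 := by
    exact_mod_cast Finset.card_le_four
  -- With `δ = ε / 16`, the choice `t = 64 m / (n ε)` makes the linear term `4 m`. The quadratic
  -- term is at most `2 m` by `hp`, where `2048 = 64^2 / 2`.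
  have hexp : n * (sig r ^ B.card / sig r ^ 2 * (64 * m / (n * ε)) ^ 2 -
      64 * m / (n * ε) * (ε / 16)) ≤ -2 * m := by
    have e1 : (n : ℝ) * (64 * m / (n * ε) * (ε / 16)) = 4 * m := by field_simp; norm_num
    have e2 : n * (sig r ^ B.card / sig r ^ 2 * (64 * m / (n * ε)) ^ 2) =
        2 * m * ((2048 / sig r ^ 2 * sig r ^ B.card * m) / (n * ε ^ 2)) := by
      field_simp; norm_num
    have e3 : (2048 / sig r ^ 2 * sig r ^ B.card * m) / (n * ε ^ 2) ≤ 1 :=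
      div_le_one_of_le₀ hp (by positivity)
    rw [mul_sub, e1, e2]
    nlinarith
  calc _ ≤ 4 * 2 ^ B.card * (2 * Real.exp (-2 * m)) := by gcongr
    _ = _ := by ring

end Probability

end IsingNeighborhood

/-! ### Consistency of the estimator. -/

theorem mainTheorem2 {d : ℕ} (hd : 1 ≤ d) (J : Site d → Site d → ℝ)
    (hJ : IsPairwisePotential J)
    (hr : (⨆ i, ∑' j, ENNReal.ofReal |J i j|) < 1)
    (htail : Tendsto
      (fun L : ℕ => ⨆ i : Site d, ∑' j : {j : Site d // (L : ℝ) < ‖j - i‖},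
        ENNReal.ofReal (|J i j| * Real.exp ((2 * (L : ℝ)) ^ d)))
      atTop (𝓝 0))
    (μ : Measure (Config d)) (hμ : IsIsingLaw J μ)
    {Ω : Type*} [MeasurableSpace Ω] (P : Measure Ω) [IsProbabilityMeasure P]
    (X : ℕ → Ω → Config d) (hXm : ∀ k, Measurable (X k))
    (hXlaw : ∀ k, P.map (X k) = μ) (hXindep : iIndepFun X P)
    (C : ℝ) (hC : 0 < C) (i : Site d) :
    (∀ j ∈ interactionNbhd J i,
      Tendsto (fun n : ℕ => P {ω | j ∈ estimator (fun k => X k ω) n (radius d n)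
        (threshold d C (radius d n) n) i}) atTop (𝓝 1)) ∧
    (∀ j ∉ interactionNbhd J i,
      Tendsto (fun n : ℕ => P {ω | j ∉ estimator (fun k => X k ω) n (radius d n)
        (threshold d C (radius d n) n) i}) atTop (𝓝 1)) := by

  classical
  have hs := summable_abs_of_iSup_lt hr
  obtain ⟨r, hr1, hr⟩ := exists_uniform_bound hr
  have htail' := eventually_tail_le hd hs htail i
  have hdecay := tendsto_exp_neg_div_threshold hd hC
  have hM := tendsto_card_box hd i
  have hne : Nonempty (Config d) := ⟨fun _ => ⟨1, by simp⟩⟩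
  refine ⟨fun j hj => ?_, fun j hj => ?_⟩
  · have hj : J i j ≠ 0 := hj
    have hij : i ≠ j := by rintro rfl; exact hj (hJ.diag_zero i)
    obtain ⟨κ₁, hκ₁, hgap₁⟩ := exists_sig_gap (b := 2 * J i j) (by simpa using hj)
    obtain ⟨κ₂, hκ₂, hgap₂⟩ := exists_sig_gap (b := -(2 * J i j)) (by simpa using hj)
    set κ := min κ₁ κ₂
    have hκ : 0 < κ := lt_min hκ₁ hκ₂
    have hgap : ∀ x : Config d, κ ≤ |sig (siteField J i (x i) x) -
        sig (siteField J i (x i) x - 2 * (J i j * spinVal (x i) * spinVal (x j)))| := fun x => by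
      have hx : |siteField J i (x i) x| ≤ 1 :=
        (abs_siteField_le (hs i) _ _).trans ((hr i).trans hr1.le)
      have hsq : |spinVal (x i) * spinVal (x j)| = 1 := by
        rw [abs_mul, abs_spinVal, abs_spinVal, mul_one]
      rw [mul_assoc (J i j)]
      rcases eq_or_eq_neg_of_abs_eq hsq with h | h
      · rw [h, mul_one]
        exact (min_le_left _ _).trans (hgap₁ _ hx)
      · rw [h, mul_neg_one, mul_neg]
        exact (min_le_right _ _).trans (hgap₂ _ hx)
    have hgain : 0 < (1 - sig r) * (κ / 2) :=
      mul_pos (by linarith [sig_lt_one r]) (by linarith)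
    have hthr := tendsto_threshold_mul_two_pow hM hd hC
    -- The bound on the outside interaction is eventually below `ε`, hence below `ε * 2 ^ M`, which
    -- tends to zero.
    have hthr0 : Tendsto (fun n => Real.exp (-(2 * (⌊radius d n⌋₊ : ℝ)) ^ d)) atTop (𝓝 0) := by
      refine squeeze_zero' (Eventually.of_forall fun n => (Real.exp_pos _).le) ?_ hthr
      filter_upwards [hdecay.eventually_lt_const one_pos,
        (eventually_mul_volScale_le_mul_threshold hd hC 1),
        tendsto_volScale.eventually_gt_atTop 0, eventually_gt_atTop 0] with n h1 h2 h3 h4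
      have hε : 0 < threshold d C (radius d n) n :=
        pos_of_mul_pos_right (lt_of_lt_of_le (by linarith) h2) (Nat.cast_nonneg n)
      rw [div_lt_one hε] at h1
      exact h1.le.trans (le_mul_of_one_le_right hε.le (one_le_pow₀ one_le_two))
    refine tendsto_measure_one_of_compl_subset ?_
      (hμ.tendsto_real_deviation hd hs hr hr1 hXm hXlaw hXindep hC hij)
    filter_upwards [eventually_mem_box hd i j, htail',
      hthr.eventually_lt_const (half_pos hgain),
      hthr0.eventually_lt_const (show 0 < κ / 4 by linarith)] with n hjn htn hthr hdec ω hω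
    simp only [Set.mem_compl_iff, Set.mem_ofPred_eq, not_exists, not_and, not_le] at hω
    obtain ⟨x, hx⟩ := hμ.exists_le_empDist hs hr hij hjn (hJ.diag_zero i) hgap hκ.le
      (by linarith) (coe_boxFinset (radius_nonneg d n) i) (n := n)
      (fun F hF x => (hω F hF x).le)
    -- A real supremum dominates its terms only for a bounded family; `2` is such a bound.
    refine ⟨hjn, lt_of_lt_of_le ?_ (le_ciSup ⟨2, ?_⟩ x)⟩
    · refine lt_of_lt_of_le ?_ hx
      have hε := threshold_nonneg (d := d) hC.le (radius d n) n
      have hpow : (0 : ℝ) < (1 / 2) ^ (boxFinset ⌊radius d n⌋₊ i).card := by positivity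
      have h := mul_lt_mul_of_pos_left hthr hpow
      have h2 : (1 / 2 : ℝ) ^ (boxFinset ⌊radius d n⌋₊ i).card *
          (threshold d C (radius d n) n * 2 ^ (boxFinset ⌊radius d n⌋₊ i).card) =
          threshold d C (radius d n) n := by
        rw [mul_left_comm, ← mul_pow]; norm_num
      rw [h2] at h
      linarith
    · rintro _ ⟨x, rfl⟩
      exact empDist_le_two _ _ hjn hij x
  · have hj : J i j = 0 := not_not.1 hj
    by_cases hij : i = j
    · subst hij
      have hall : ∀ n, {ω | i ∉ estimator (fun k => X k ω) n (radius d n)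
          (threshold d C (radius d n) n) i} = Set.univ := fun n =>
        Set.eq_univ_of_forall fun ω h => by
          have h2 := h.2
          simp only [empDist_self, ciSup_const] at h2
          exact absurd h2 (threshold_nonneg hC.le _ n).not_gt
      simp only [hall, measure_univ]
      exact tendsto_const_nhds
    · refine tendsto_measure_one_of_compl_subset ?_
        (hμ.tendsto_real_deviation hd hs hr hr1 hXm hXlaw hXindep hC hij)
      filter_upwards [eventually_mem_box hd i j, htail',
        hdecay.eventually_lt_const (show (0 : ℝ) < 1 / 16 by norm_num),
        (eventually_mul_volScale_le_mul_threshold hd hC 1),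
        tendsto_volScale.eventually_gt_atTop 0] with n hjn htn hdec h2 h3 ω hω
      simp only [Set.mem_compl_iff, Set.mem_ofPred_eq, not_exists, not_and, not_le] at hω
      have hε : 0 < threshold d C (radius d n) n :=
        pos_of_mul_pos_right (lt_of_lt_of_le (by linarith) h2) (Nat.cast_nonneg n)
      rw [div_lt_iff₀ hε] at hdec
      rintro ⟨-, hlt⟩
      refine absurd hlt (not_lt.2 (ciSup_le fun x => ?_))
      -- Sampling error `4 * ε / 16` and outside interaction below `2 * ε / 16` together stay under
      -- `ε`.
      have := hμ.empDist_le (hs i) hjn hij (hJ.diag_zero i) hj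
        (fun F hF x => (hω F hF x).le) x
      linarith
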